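/- Let $A=KL$ be the product of two real skew-symmetric $4\times 4$ matrices $K,L$ of determinant $1$. Say that $A\in SL(4,\mathbb R)$ is conjugate to $N$ in $SL(4)$ up to scale if $A=r\,CNC^{-1}$ for some $C\in SL(4,\mathbb R)$ and some real $r\neq 0$. (a) There is exactly one $i\in\{1,\dots,6\}$ such that $A$ is conjugate in $SL(4)$, up to scale, to some matrix of the $i$-th of the following six families: 1. $\begin{pmatrix} c&-s&0&0\\ s&c&0&0\\ 0&0&c&-s\\ 0&0&s&c\end{pmatrix}$, where $c=\cos\theta$, $s=\sin\theta\neq 0$; 2. $\begin{pmatrix} c&s&0&0\\ -s&c&0&0\\ 0&0&c&-s\\ 0&0&s&c\end{pmatrix}$, where $c=\cos\theta$, $s=\sin\theta\neq 0$; 3. $\begin{pmatrix} 1&-\lambda&0&0\\ 0&1&0&0\\ 0&0&1&0\\ 0&0&\lambda&1\end{pmatrix}$, where $\lambda\neq 0$; 4. $\begin{pmatrix} 1&\lambda&0&0\\ 0&1&0&0\\ 0&0&1&0\\ 0&0&\lambda&1\end{pmatrix}$, where $\lambda\neq 0$; 5. $\mathrm{diag}(\lambda^{-1},\lambda^{-1},\lambda,\lambda)$,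 where $\lambda>0$; 6. $\mathrm{diag}(\lambda^{-1},\lambda^{-1},-\lambda,-\lambda)$, where $\lambda>0$. (b) Let $\mathbb R^{3,3}=\Lambda^2(\mathbb R^4)$, where $(x,y)\in\mathbb R^3\times\mathbb R^3$ stands for $x_1e_{01}+x_2e_{02}+x_3e_{03}+y_1e_{23}+y_2e_{31}+y_3e_{12}$, with inner product $(x_1,y_1)\cdot(x_2,y_2)=x_1\cdot y_2+y_1\cdot x_2$. For $U\in\mathbb R^{3,3}$ with $U\cdot U\ne0$ let $\mathrm{Ad}^*_U(X)=X-2\frac{X\cdot U}{U\cdot U}U$ be the reflection with respect to $U$. Say that $A$ represents a map $B$ of $\mathbb R^{3,3}$ if $B(p\wedge\mathbb R^4)=(Ap)\wedge\mathbb R^4$ for every $p\in\mathbb R^4$. Then there are $U,V\in\mathbb R^{3,3}$ with $|U\cdot U|=|V\cdot V|=1$ such that $A$ represents $\mathrm{Ad}^*_U\circ\mathrm{Ad}^*_V$. (c) Let $U,V\in\mathbb R^{3,3}$ be any vectors with $U\cdot U\neq0$ and $V\cdot V\neq 0$ such that $A$ represents $\mathrm{Ad}^*_U\circ\mathrm{Ad}^*_V$.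 Then $U,V$ are linearly dependent if and only if $A=\pm I$ (which belongs to family 5). If $U,V$ are linearly independent, then the family of $A$ in (a) is determined by the signature of the plane $W=\mathrm{span}(U,V)$, where signature $\mathbb R^{p,q,r}$ means that $W$ has an orthogonal basis of $p$ vectors of square $1$, $q$ of square $-1$ and $r$ of square $0$. Namely, $A$ belongs to family 1. iff $W$ has signature $\mathbb R^{2,0,0}$; 2. iff $W$ has signature $\mathbb R^{0,2,0}$; 3. iff $W$ has signature $\mathbb R^{1,0,1}$; 4. iff $W$ has signature $\mathbb R^{0,1,1}$; 5. iff $W$ has signature $\mathbb R^{1,1,0}$ and $(U\cdot U)(V\cdot V)>0$; 6. iff $W$ has signature $\mathbb R^{1,1,0}$ and $(U\cdot U)(V\cdot V)<0$. -/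

import Mathlib

/-- Real `4 × 4` matrices of determinant one. -/
abbrev SL4 : Type := Matrix.SpecialLinearGroup (Fin 4) ℝ

/-- `M` is a nonzero scalar multiple of a conjugate, by an element of `SL(4)`, of the matrix `N`. -/
def IsConjUpToScale (M N : Matrix (Fin 4) (Fin 4) ℝ) : Prop :=
  ∃ r : ℝ, r ≠ 0 ∧ ∃ C : SL4,
    M = r • ((C : Matrix (Fin 4) (Fin 4) ℝ) * N * ((C⁻¹ : SL4) : Matrix (Fin 4) (Fin 4) ℝ))

/-- The six families of block diagonal matrices. -/
def normalForms : Fin 6 → Set (Matrix (Fin 4) (Fin 4) ℝ) :=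
  ![{N | ∃ θ : ℝ, Real.sin θ ≠ 0 ∧
      N = !![Real.cos θ, -Real.sin θ, 0, 0;
             Real.sin θ, Real.cos θ, 0, 0;
             0, 0, Real.cos θ, -Real.sin θ;
             0, 0, Real.sin θ, Real.cos θ]},
    {N | ∃ θ : ℝ, Real.sin θ ≠ 0 ∧
      N = !![Real.cos θ, Real.sin θ, 0, 0;
             -Real.sin θ, Real.cos θ, 0, 0;
             0, 0, Real.cos θ, -Real.sin θ;
             0, 0, Real.sin θ, Real.cos θ]},
    {N | ∃ l : ℝ, l ≠ 0 ∧
      N = !![1, -l, 0, 0;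
             0, 1, 0, 0;
             0, 0, 1, 0;
             0, 0, l, 1]},
    {N | ∃ l : ℝ, l ≠ 0 ∧
      N = !![1, l, 0, 0;
             0, 1, 0, 0;
             0, 0, 1, 0;
             0, 0, l, 1]},
    {N | ∃ l : ℝ, 0 < l ∧ N = Matrix.diagonal ![l⁻¹, l⁻¹, l, l]},
    {N | ∃ l : ℝ, 0 < l ∧ N = Matrix.diagonal ![l⁻¹, l⁻¹, -l, -l]}]

/-- `A` is conjugate in `SL(4)`, up to scale, to some member of the `i`-th family. -/
def HasNormalForm (A : SL4) (i : Fin 6) : Prop :=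
  ∃ N ∈ normalForms i, IsConjUpToScale (A : Matrix (Fin 4) (Fin 4) ℝ) N

/-- The space `ℝ^{3,3} = Λ²(ℝ⁴)` of Plücker coordinates in screw form: `(x, y)` stands for
`x₁ e₀₁ + x₂ e₀₂ + x₃ e₀₃ + y₁ e₂₃ + y₂ e₃₁ + y₃ e₁₂`. -/
abbrev ScrewSpace : Type := (Fin 3 → ℝ) × (Fin 3 → ℝ)

/-- The inner product `(x₁, y₁) · (x₂, y₂) = x₁ · y₂ + y₁ · x₂` of signature `(3,3)`. -/
def screwInner (X Y : ScrewSpace) : ℝ :=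
  dotProduct X.1 Y.2 + dotProduct X.2 Y.1

/-- The Plücker coordinates of `p ∧ q` for `p, q ∈ ℝ⁴`. -/
def pluckerJoin (p q : Fin 4 → ℝ) : ScrewSpace :=
  (fun i => p 0 * q i.succ - q 0 * p i.succ,
    crossProduct (fun i : Fin 3 => p i.succ) (fun i : Fin 3 => q i.succ))

/-- The space `p ∧ ℝ⁴`; for `p ≠ 0` it is the null 3-space representing the projective
point `p`. -/
def pointSpace (p : Fin 4 → ℝ) : Set ScrewSpace :=
  Set.range (pluckerJoin p)

/-- The reflection of `ℝ^{3,3}` in the hyperplane orthogonal to the vector `U`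
(used only for `U · U ≠ 0`). -/
noncomputable def screwReflection (U X : ScrewSpace) : ScrewSpace :=
  X - (2 * screwInner X U / screwInner U U) • U

/-- `A` is a `4 × 4` matrix representation of the map `B` of `ℝ^{3,3}`: the action of `B` on the
null 3-spaces that represent points is the projective transformation `p ↦ A p`. -/
def IsMatrixRepresentation (A : SL4) (B : ScrewSpace → ScrewSpace) : Prop :=
  ∀ p : Fin 4 → ℝ,
    B '' pointSpace p = pointSpace (Matrix.mulVec (A : Matrix (Fin 4) (Fin 4) ℝ) p)

/-- The subspace `W` of `ℝ^{3,3}` has signature `ℝ^{p,q,r}`: it has an orthogonal basis consisting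
of `p` vectors of square `1`, `q` vectors of square `-1` and `r` vectors of square `0`. -/
def HasSignature (W : Submodule ℝ ScrewSpace) (p q r : ℕ) : Prop :=
  ∃ b : Module.Basis (Fin p ⊕ Fin q ⊕ Fin r) ℝ W,
    (∀ i j, i ≠ j → screwInner (b i) (b j) = 0) ∧
    (∀ i, screwInner (b (Sum.inl i)) (b (Sum.inl i)) = 1) ∧
    (∀ i, screwInner (b (Sum.inr (Sum.inl i))) (b (Sum.inr (Sum.inl i))) = -1) ∧
    (∀ i, screwInner (b (Sum.inr (Sum.inr i))) (b (Sum.inr (Sum.inr i))) = 0)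

open Matrix

/-! Write P, D, ⟨ , ⟩ for `pluckerMatrix`, `dualMatrix`, `screwInner`. The relation P(X)D(Y) +
P(Y)D(X) = -⟨X,Y⟩I makes P and D a matrix model of the Clifford algebra of ℝ^{3,3}. The reflection
in U becomes P(X) ↦ (2/⟨U,U⟩) P(U)D(X)P(U), so two reflections compose to P(X) ↦ const · M P(X) Mᵀ
with M = P(U)D(V). Since P(p ∧ q) = pqᵀ - qpᵀ, this sends p ∧ ℝ⁴ to Mp ∧ ℝ⁴, and A represents the
composition exactly when A is a nonzero multiple of M (`isMatrixRepresentation_iff`). A skew matrix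
of determinant 1 is √2 P(X) with ⟨X,X⟩ = ±1, and equally √2 D(Y), so A = KL has this shape.

For independent U, V take an orthogonal basis X, Y of their plane. Then A = mI + nJ with n ≠ 0, J =
2P(X)D(Y) and J² = -⟨X,X⟩⟨Y,Y⟩I (`exists_decomposition`, `two_smul_mul_self`): the signature decides
whether J is a complex structure, square-zero or an involution. The first two families are
interchanged by orientation-reversing conjugation, and so are the next two; the sign of det(p, Jp,
q, Jq) tells them apart, and `screwInner_mul_chirality` shows that in these cases it is the sign of
⟨Y,Y⟩. For an involution the eigenvalues are m ± n, and their product has the sign of ⟨U,U⟩⟨V,V⟩.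
The vectors p, Jp, q, Jq, suitably combined, form the conjugating basis.

Traces and the sign of det(p, Ap, q, Aq) make the families mutually exclusive
(`HasNormalForm.unique`). As the possible signatures are exhausted, the implications from signature
to family are equivalences. -/

/-- The skew-symmetric matrix of a bivector. -/
def pluckerMatrix (X : ScrewSpace) : Matrix (Fin 4) (Fin 4) ℝ :=
  !![0, X.1 0, X.1 1, X.1 2;
     -X.1 0, 0, X.2 2, -X.2 1;
     -X.1 1, -X.2 2, 0, X.2 0;
     -X.1 2, X.2 1, -X.2 0, 0]

/-- The skew-symmetric matrix of the dual of a bivector. -/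
def dualMatrix (X : ScrewSpace) : Matrix (Fin 4) (Fin 4) ℝ :=
  pluckerMatrix X.swap

/-! ### Bilinearity and the Clifford relations -/

lemma screwInner_eq (X Y : ScrewSpace) : screwInner X Y =
    X.1 0 * Y.2 0 + X.1 1 * Y.2 1 + X.1 2 * Y.2 2 +
      (X.2 0 * Y.1 0 + X.2 1 * Y.1 1 + X.2 2 * Y.1 2) := by
  simp [screwInner, dotProduct, Fin.sum_univ_three]

lemma screwInner_comm (X Y : ScrewSpace) : screwInner X Y = screwInner Y X := by
  simp only [screwInner_eq]; ring

lemma screwInner_add_left (X Y Z : ScrewSpace) :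
    screwInner (X + Y) Z = screwInner X Z + screwInner Y Z := by
  simp only [screwInner_eq, Prod.fst_add, Prod.snd_add, Pi.add_apply]; ring

lemma screwInner_smul_left (a : ℝ) (X Y : ScrewSpace) :
    screwInner (a • X) Y = a * screwInner X Y := by
  simp only [screwInner_eq, Prod.smul_fst, Prod.smul_snd, Pi.smul_apply, smul_eq_mul]; ring

lemma screwInner_add_right (X Y Z : ScrewSpace) :
    screwInner X (Y + Z) = screwInner X Y + screwInner X Z := by
  rw [screwInner_comm, screwInner_add_left, screwInner_comm Y, screwInner_comm Z]

lemma screwInner_smul_right (a : ℝ) (X Y : ScrewSpace) :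
    screwInner X (a • Y) = a * screwInner X Y := by
  rw [screwInner_comm, screwInner_smul_left, screwInner_comm]

lemma screwInner_swap (X Y : ScrewSpace) : screwInner X.swap Y.swap = screwInner X Y := by
  simp only [screwInner_eq, Prod.fst_swap, Prod.snd_swap]; ring

lemma pluckerMatrix_add (X Y : ScrewSpace) :
    pluckerMatrix (X + Y) = pluckerMatrix X + pluckerMatrix Y := by
  ext i j; fin_cases i <;> fin_cases j <;> simp [pluckerMatrix] <;> ring

lemma pluckerMatrix_smul (a : ℝ) (X : ScrewSpace) :
    pluckerMatrix (a • X) = a • pluckerMatrix X := by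
  ext i j; fin_cases i <;> fin_cases j <;> simp [pluckerMatrix]

lemma dualMatrix_add (X Y : ScrewSpace) :
    dualMatrix (X + Y) = dualMatrix X + dualMatrix Y :=
  pluckerMatrix_add X.swap Y.swap

lemma dualMatrix_smul (a : ℝ) (X : ScrewSpace) :
    dualMatrix (a • X) = a • dualMatrix X :=
  pluckerMatrix_smul a X.swap

lemma pluckerMatrix_transpose (X : ScrewSpace) :
    (pluckerMatrix X)ᵀ = -pluckerMatrix X := by
  ext i j; fin_cases i <;> fin_cases j <;> simp [pluckerMatrix]

lemma dualMatrix_transpose (X : ScrewSpace) : (dualMatrix X)ᵀ = -dualMatrix X :=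
  pluckerMatrix_transpose X.swap

lemma pluckerMatrix_injective : Function.Injective pluckerMatrix := by
  intro X Y h
  have e : ∀ i j, pluckerMatrix X i j = pluckerMatrix Y i j := fun i j => by rw [h]
  have h1 := e 0 1
  have h2 := e 0 2
  have h3 := e 0 3
  have h4 := e 2 3
  have h5 := e 3 1
  have h6 := e 1 2
  simp [pluckerMatrix] at h1 h2 h3 h4 h5 h6
  ext i <;> fin_cases i <;> assumption

lemma exists_pluckerMatrix_eq {K : Matrix (Fin 4) (Fin 4) ℝ} (hK : Kᵀ = -K) :
    ∃ X, pluckerMatrix X = K := by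
  have e : ∀ i j, K j i = -K i j := fun i j => congrFun (congrFun hK i) j
  have d : ∀ i, K i i = 0 := fun i => by linarith [e i i]
  refine ⟨(![K 0 1, K 0 2, K 0 3], ![K 2 3, K 3 1, K 1 2]), ?_⟩
  ext i j
  fin_cases i <;> fin_cases j <;>
    simp [pluckerMatrix, d, e 0 1, e 0 2, e 0 3, e 2 3, e 3 1, e 1 2]

/-- The Pfaffian of the matrix is half the square of the bivector, by the Plücker quadric. -/
lemma det_pluckerMatrix (X : ScrewSpace) :
    (pluckerMatrix X).det = (screwInner X X / 2) ^ 2 := by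
  simp [pluckerMatrix, det_succ_row_zero, Fin.sum_univ_succ, screwInner_eq, Fin.succAbove]
  ring

lemma det_dualMatrix (X : ScrewSpace) :
    (dualMatrix X).det = (screwInner X X / 2) ^ 2 := by
  rw [dualMatrix, det_pluckerMatrix, screwInner_swap]

/-- The Clifford relation. -/
lemma pluckerMatrix_mul_dualMatrix_add (X Y : ScrewSpace) :
    pluckerMatrix X * dualMatrix Y + pluckerMatrix Y * dualMatrix X =
      (-screwInner X Y) • (1 : Matrix (Fin 4) (Fin 4) ℝ) := by
  ext i j
  fin_cases i <;> fin_cases j <;>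
    simp [pluckerMatrix, dualMatrix, screwInner_eq] <;> ring

lemma dualMatrix_mul_pluckerMatrix_add (X Y : ScrewSpace) :
    dualMatrix X * pluckerMatrix Y + dualMatrix Y * pluckerMatrix X =
      (-screwInner X Y) • (1 : Matrix (Fin 4) (Fin 4) ℝ) := by
  rw [← screwInner_swap]
  exact pluckerMatrix_mul_dualMatrix_add X.swap Y.swap

lemma pluckerMatrix_mul_dualMatrix_self (X : ScrewSpace) :
    pluckerMatrix X * dualMatrix X =
      (-(screwInner X X / 2)) • (1 : Matrix (Fin 4) (Fin 4) ℝ) := by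
  have h := pluckerMatrix_mul_dualMatrix_add X X
  rw [← two_smul ℝ] at h
  rw [← inv_smul_smul₀ (two_ne_zero' ℝ) (pluckerMatrix X * dualMatrix X), h, smul_smul]
  congr 1; ring

lemma dualMatrix_mul_pluckerMatrix_self (X : ScrewSpace) :
    dualMatrix X * pluckerMatrix X =
      (-(screwInner X X / 2)) • (1 : Matrix (Fin 4) (Fin 4) ℝ) := by
  rw [← screwInner_swap]
  exact pluckerMatrix_mul_dualMatrix_self X.swap

/-! ### Reflections and the projective maps they induce -/

/-- Multiply the Clifford relation for U, X by P(U) on the right and use that D(U)P(U) is scalar. -/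
lemma pluckerMatrix_screwReflection {U : ScrewSpace} (hU : screwInner U U ≠ 0) (X : ScrewSpace) :
    pluckerMatrix (screwReflection U X) =
      (2 / screwInner U U) • (pluckerMatrix U * dualMatrix X * pluckerMatrix U) := by
  have h := pluckerMatrix_mul_dualMatrix_add U X
  rw [← eq_sub_iff_add_eq] at h
  rw [h, sub_mul, mul_assoc, dualMatrix_mul_pluckerMatrix_self, screwReflection, sub_eq_add_neg,
    ← neg_smul, pluckerMatrix_add, pluckerMatrix_smul, smul_mul_assoc, mul_smul_comm, one_mul,
    mul_one, smul_sub, smul_smul, smul_smul, screwInner_comm X U, sub_eq_add_neg, ← neg_smul,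
    add_comm]
  congr 2
  · ring
  · rw [show -(2 / screwInner U U * -(screwInner U U / 2)) = 1 by field_simp, one_smul]

lemma dualMatrix_screwReflection {U : ScrewSpace} (hU : screwInner U U ≠ 0) (X : ScrewSpace) :
    dualMatrix (screwReflection U X) =
      (2 / screwInner U U) • (dualMatrix U * pluckerMatrix X * dualMatrix U) := by
  have h := pluckerMatrix_screwReflection (U := U.swap) (by rwa [screwInner_swap]) X.swap
  rw [screwInner_swap] at h
  simp only [screwReflection, screwInner_swap] at h
  exact h

lemma pluckerMatrix_pluckerJoin (p q : Fin 4 → ℝ) :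
    pluckerMatrix (pluckerJoin p q) = vecMulVec p q - vecMulVec q p := by
  ext i j
  fin_cases i <;> fin_cases j <;>
    simp [pluckerMatrix, pluckerJoin, vecMulVec_apply, crossProduct] <;> ring

/-- The two signs from transposing skew matrices cancel, so D(V)P(U) is the transpose of P(U)D(V)
and the action is a congruence. -/
lemma pluckerMatrix_comp_screwReflection {U V : ScrewSpace} (hU : screwInner U U ≠ 0)
    (hV : screwInner V V ≠ 0) (X : ScrewSpace) :
    pluckerMatrix ((screwReflection U ∘ screwReflection V) X) =
      (4 / (screwInner U U * screwInner V V)) •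
        ((pluckerMatrix U * dualMatrix V) * pluckerMatrix X *
          (pluckerMatrix U * dualMatrix V)ᵀ) := by
  rw [Function.comp, pluckerMatrix_screwReflection hU, dualMatrix_screwReflection hV,
    transpose_mul, pluckerMatrix_transpose, dualMatrix_transpose]
  simp only [mul_smul_comm, smul_mul_assoc, smul_smul, mul_assoc, neg_mul, mul_neg, neg_neg]
  congr 1
  field_simp; norm_num

lemma comp_screwReflection_pluckerJoin {U V : ScrewSpace} (hU : screwInner U U ≠ 0)
    (hV : screwInner V V ≠ 0) (p q : Fin 4 → ℝ) :
    (screwReflection U ∘ screwReflection V) (pluckerJoin p q) =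
      pluckerJoin ((pluckerMatrix U * dualMatrix V) *ᵥ p)
        ((4 / (screwInner U U * screwInner V V)) • ((pluckerMatrix U * dualMatrix V) *ᵥ q)) := by
  apply pluckerMatrix_injective
  rw [pluckerMatrix_comp_screwReflection hU hV, pluckerMatrix_pluckerJoin,
    pluckerMatrix_pluckerJoin]
  generalize pluckerMatrix U * dualMatrix V = M
  rw [mul_sub, sub_mul, mul_vecMulVec, mul_vecMulVec, vecMulVec_mul, vecMulVec_mul,
    vecMul_transpose, vecMul_transpose, vecMulVec_smul, smul_vecMulVec, smul_sub]

lemma det_pluckerMatrix_mul_dualMatrix_ne_zero {U V : ScrewSpace} (hU : screwInner U U ≠ 0)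
    (hV : screwInner V V ≠ 0) : (pluckerMatrix U * dualMatrix V).det ≠ 0 := by
  rw [det_mul, det_pluckerMatrix, det_dualMatrix]
  positivity

lemma pointSpace_smul {r : ℝ} (hr : r ≠ 0) (p : Fin 4 → ℝ) :
    pointSpace (r • p) = pointSpace p := by
  have h : ∀ q, pluckerJoin (r • p) q = pluckerJoin p (r • q) := fun q => by
    apply pluckerMatrix_injective
    simp only [pluckerMatrix_pluckerJoin, vecMulVec_smul, smul_vecMulVec]
  ext X
  constructor
  · rintro ⟨q, rfl⟩
    exact ⟨r • q, (h q).symm⟩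
  · rintro ⟨q, rfl⟩
    exact ⟨r⁻¹ • q, by rw [h, smul_inv_smul₀ hr]⟩

lemma comp_screwReflection_image_pointSpace {U V : ScrewSpace} (hU : screwInner U U ≠ 0)
    (hV : screwInner V V ≠ 0) (p : Fin 4 → ℝ) :
    (screwReflection U ∘ screwReflection V) '' pointSpace p =
      pointSpace ((pluckerMatrix U * dualMatrix V) *ᵥ p) := by
  have hM := det_pluckerMatrix_mul_dualMatrix_ne_zero hU hV
  rw [pointSpace, ← Set.range_comp]
  ext X
  constructor
  · rintro ⟨q, rfl⟩
    exact ⟨_, (comp_screwReflection_pluckerJoin hU hV p q).symm⟩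
  · rintro ⟨q, rfl⟩
    refine ⟨(pluckerMatrix U * dualMatrix V)⁻¹ *ᵥ
      ((4 / (screwInner U U * screwInner V V))⁻¹ • q), ?_⟩
    rw [Function.comp_apply, comp_screwReflection_pluckerJoin hU hV, mulVec_mulVec,
      mul_nonsing_inv _ hM.isUnit, one_mulVec, smul_inv_smul₀ (by positivity)]

/-- The vector a is recovered up to scale from its joins a ∧ eₖ: if each of them has b as a factor,
then a is parallel to b. -/
lemma mul_eq_mul_of_pointSpace_subset {a b : Fin 4 → ℝ} (h : pointSpace a ⊆ pointSpace b)
    (i j : Fin 4) : a i * b j = a j * b i := by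
  have key : ∀ i j k : Fin 4, i ≠ k → j ≠ k → i ≠ j → a i * b j = a j * b i := by
    intro i j k hik hjk hij
    obtain ⟨t, ht⟩ := h ⟨Pi.single k 1, rfl⟩
    have e := congrArg pluckerMatrix ht
    rw [pluckerMatrix_pluckerJoin, pluckerMatrix_pluckerJoin] at e
    have e1 := congrFun (congrFun e i) j
    have e2 := congrFun (congrFun e i) k
    have e3 := congrFun (congrFun e j) k
    simp [vecMulVec_apply, hik, hjk] at e1 e2 e3
    linear_combination -b j * e2 + b i * e3 + b k * e1
  rcases eq_or_ne i j with rfl | hij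
  · rfl
  -- In dimension 4 a third index is always available as the test direction.
  · obtain ⟨k, hk⟩ : ∃ k : Fin 4, i ≠ k ∧ j ≠ k := by revert i j; decide
    exact key i j k hk.1 hk.2 hij

lemma exists_eq_smul_one_of_forall_mulVec {T : Matrix (Fin 4) (Fin 4) ℝ}
    (h : ∀ p i j, (T *ᵥ p) i * p j = (T *ᵥ p) j * p i) : ∃ r : ℝ, T = r • 1 := by
  have off : ∀ i k, i ≠ k → T i k = 0 := fun i k hik => by
    simpa [hik] using h (Pi.single k 1) i k
  refine ⟨T 0 0, ?_⟩
  ext i j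
  rcases eq_or_ne i j with rfl | hij
  · have := h (fun _ => 1) 0 i
    simp only [mulVec, dotProduct, mul_one] at this
    rw [Finset.sum_eq_single 0 (fun k _ hk => off 0 k hk.symm) (by simp),
      Finset.sum_eq_single i (fun k _ hk => off i k hk.symm) (by simp)] at this
    simp [this]
  · simp [off i j hij, hij]

/-- Equal point spaces force Ap and Mp to be parallel, so AM⁻¹ preserves every line and is a scalar.
-/
lemma isMatrixRepresentation_iff (A : SL4) {U V : ScrewSpace} (hU : screwInner U U ≠ 0)
    (hV : screwInner V V ≠ 0) :
    IsMatrixRepresentation A (screwReflection U ∘ screwReflection V) ↔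
      ∃ r : ℝ, r ≠ 0 ∧
        (A : Matrix (Fin 4) (Fin 4) ℝ) = r • (pluckerMatrix U * dualMatrix V) := by
  simp only [IsMatrixRepresentation, comp_screwReflection_image_pointSpace hU hV]
  have hM := det_pluckerMatrix_mul_dualMatrix_ne_zero hU hV
  generalize pluckerMatrix U * dualMatrix V = M at hM
  constructor
  · intro h
    obtain ⟨r, hr⟩ := exists_eq_smul_one_of_forall_mulVec (T := A.1 * M⁻¹) (by
      intro p i j
      have := mul_eq_mul_of_pointSpace_subset (h (M⁻¹ *ᵥ p)).ge i j
      rwa [mulVec_mulVec, mulVec_mulVec, mul_nonsing_inv _ hM.isUnit, one_mulVec] at this)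
    have hA : A.1 = r • M := by
      have := congrArg (· * M) hr
      simpa [mul_assoc, nonsing_inv_mul _ hM.isUnit] using this
    refine ⟨r, ?_, hA⟩
    rintro rfl
    have := A.2
    rw [hA] at this
    simp at this
  · rintro ⟨r, hr, h⟩ p
    rw [h, smul_mulVec, pointSpace_smul hr]

/-! ### Invariants separating the six families -/

/-- The matrix with columns `a, b, c, d`. -/
def columns (a b c d : Fin 4 → ℝ) : Matrix (Fin 4) (Fin 4) ℝ :=
  (Matrix.of ![a, b, c, d])ᵀ

lemma det_columns (a b c d : Fin 4 → ℝ) : (columns a b c d).det =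
    a 0 * (b 1 * (c 2 * d 3 - c 3 * d 2) - b 2 * (c 1 * d 3 - c 3 * d 1)
      + b 3 * (c 1 * d 2 - c 2 * d 1))
    - a 1 * (b 0 * (c 2 * d 3 - c 3 * d 2) - b 2 * (c 0 * d 3 - c 3 * d 0)
      + b 3 * (c 0 * d 2 - c 2 * d 0))
    + a 2 * (b 0 * (c 1 * d 3 - c 3 * d 1) - b 1 * (c 0 * d 3 - c 3 * d 0)
      + b 3 * (c 0 * d 1 - c 1 * d 0))
    - a 3 * (b 0 * (c 1 * d 2 - c 2 * d 1) - b 1 * (c 0 * d 2 - c 2 * d 0)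
      + b 2 * (c 0 * d 1 - c 1 * d 0)) := by
  rw [columns, det_transpose]
  simp [det_succ_row_zero, Fin.sum_univ_succ, Fin.succAbove]
  ring

lemma mul_columns (M : Matrix (Fin 4) (Fin 4) ℝ) (a b c d : Fin 4 → ℝ) :
    M * columns a b c d = columns (M *ᵥ a) (M *ᵥ b) (M *ᵥ c) (M *ᵥ d) := by
  ext i j
  fin_cases j <;> rfl

/-- The orientation of the frame `p, A p, q, A q`. -/
def chirality (A : Matrix (Fin 4) (Fin 4) ℝ) (p q : Fin 4 → ℝ) : ℝ :=
  (columns p (A *ᵥ p) q (A *ᵥ q)).det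

/-- Because C has determinant 1 and the scale enters through two columns, only the positive factor
r² appears and the sign survives. -/
lemma chirality_conj {A N : Matrix (Fin 4) (Fin 4) ℝ} {r : ℝ} {C : SL4}
    (h : A = r • (C.1 * N * (C⁻¹ : SL4).1)) (p q : Fin 4 → ℝ) :
    chirality A (C.1 *ᵥ p) (C.1 *ᵥ q) = r ^ 2 * chirality N p q := by
  have hC : (C⁻¹ : SL4).1 * C.1 = 1 := congrArg Subtype.val (inv_mul_cancel C)
  have e : ∀ p, A *ᵥ (C.1 *ᵥ p) = C.1 *ᵥ (r • (N *ᵥ p)) := fun p => by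
    rw [h, mulVec_mulVec, smul_mul_assoc, mul_assoc, hC, mul_one, smul_mulVec, mulVec_smul,
      mulVec_mulVec]
  rw [chirality, e, e, ← mul_columns, det_mul, C.2, one_mul, chirality, det_columns, det_columns]
  simp only [Pi.smul_apply, smul_eq_mul]
  ring

lemma trace_conj {A N : Matrix (Fin 4) (Fin 4) ℝ} {r : ℝ} {C : SL4}
    (h : A = r • (C.1 * N * (C⁻¹ : SL4).1)) : A.trace = r * N.trace := by
  have hC : (C⁻¹ : SL4).1 * C.1 = 1 := congrArg Subtype.val (inv_mul_cancel C)
  rw [h, trace_smul, trace_mul_comm, ← mul_assoc, hC, one_mul, smul_eq_mul]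

lemma trace_mul_self_conj {A N : Matrix (Fin 4) (Fin 4) ℝ} {r : ℝ} {C : SL4}
    (h : A = r • (C.1 * N * (C⁻¹ : SL4).1)) : (A * A).trace = r ^ 2 * (N * N).trace := by
  have hC : (C⁻¹ : SL4).1 * C.1 = 1 := congrArg Subtype.val (inv_mul_cancel C)
  apply (trace_conj (C := C) _)
  rw [h, smul_mul_smul_comm, ← pow_two]
  congr 1
  calc _ = C.1 * N * ((C⁻¹ : SL4).1 * C.1) * N * (C⁻¹ : SL4).1 := by simp only [mul_assoc]
    _ = _ := by rw [hC, mul_one, mul_assoc C.1]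

/-- For a matrix with two double eigenvalues, four times their squared difference. -/
def traceDisc (A : Matrix (Fin 4) (Fin 4) ℝ) : ℝ := 4 * (A * A).trace - A.trace ^ 2

/-- For a matrix with two double eigenvalues, eight times their product. -/
def traceProd (A : Matrix (Fin 4) (Fin 4) ℝ) : ℝ := A.trace ^ 2 - 2 * (A * A).trace

/-- Conjugation invariant properties that tell the six families apart. -/
def familyInvariant (A : Matrix (Fin 4) (Fin 4) ℝ) : Fin 6 → Prop :=
  ![traceDisc A < 0 ∧ ∀ p q, 0 ≤ chirality A p q,
    traceDisc A < 0 ∧ ∃ p q, chirality A p q < 0,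
    traceDisc A = 0 ∧ (∀ p q, 0 ≤ chirality A p q) ∧ ∃ p q, 0 < chirality A p q,
    traceDisc A = 0 ∧ ∃ p q, chirality A p q < 0,
    0 < traceProd A ∧ (0 < traceDisc A ∨ traceDisc A = 0 ∧ ∀ p q, chirality A p q = 0),
    traceProd A < 0 ∧ 0 < traceDisc A]

/-- The sign of the discriminant separates the rotations, and chirality splits them. At discriminant
zero, chirality positive somewhere, negative somewhere or identically zero separates the two shears
from the scalar member of the fifth family; the sign of the eigenvalue product separates the last
two. -/
lemma familyInvariant_unique {A : Matrix (Fin 4) (Fin 4) ℝ} {i j : Fin 6}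
    (hi : familyInvariant A i) (hj : familyInvariant A j) : i = j := by
  wlog h : i < j generalizing i j
  · rcases lt_trichotomy i j with h | h | h
    · contradiction
    · exact h
    · exact (this hj hi h).symm
  exfalso
  fin_cases i <;> fin_cases j <;> first | (revert h; decide) | skip
  all_goals simp [familyInvariant] at hi hj
  all_goals grind

lemma familyInvariant_of_conj {A N : Matrix (Fin 4) (Fin 4) ℝ} (h : IsConjUpToScale A N)
    {i : Fin 6} (hN : familyInvariant N i) : familyInvariant A i := by
  obtain ⟨r, hr, C, h⟩ := h
  have hr2 : 0 < r ^ 2 := by positivity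
  have hd : traceDisc A = r ^ 2 * traceDisc N := by
    rw [traceDisc, traceDisc, trace_conj h, trace_mul_self_conj h]; ring
  have hp : traceProd A = r ^ 2 * traceProd N := by
    rw [traceProd, traceProd, trace_conj h, trace_mul_self_conj h]; ring
  have hq := chirality_conj h
  have hC : ∀ p, C.1 *ᵥ ((C⁻¹ : SL4).1 *ᵥ p) = p := fun p => by
    rw [mulVec_mulVec, show C.1 * (C⁻¹ : SL4).1 = 1 from congrArg Subtype.val (mul_inv_cancel C),
      one_mulVec]
  have hq' : ∀ p q, chirality A p q =
      r ^ 2 * chirality N ((C⁻¹ : SL4).1 *ᵥ p) ((C⁻¹ : SL4).1 *ᵥ q) := fun p q => by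
    rw [← hq, hC, hC]
  have d0 : traceDisc N < 0 → traceDisc A < 0 := fun h => by
    rw [hd]; exact mul_neg_of_pos_of_neg hr2 h
  have d1 : traceDisc N = 0 → traceDisc A = 0 := fun h => by rw [hd, h, mul_zero]
  have d2 : 0 < traceDisc N → 0 < traceDisc A := fun h => by rw [hd]; positivity
  have q0 : (∀ p q, 0 ≤ chirality N p q) → ∀ p q, 0 ≤ chirality A p q := fun h p q => by
    rw [hq']; exact mul_nonneg hr2.le (h _ _)
  have q1 : (∃ p q, chirality N p q < 0) → ∃ p q, chirality A p q < 0 := fun ⟨p, q, h⟩ =>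
    ⟨_, _, by rw [hq]; exact mul_neg_of_pos_of_neg hr2 h⟩
  have q2 : (∃ p q, 0 < chirality N p q) → ∃ p q, 0 < chirality A p q := fun ⟨p, q, h⟩ =>
    ⟨_, _, by rw [hq]; exact mul_pos hr2 h⟩
  have q3 : (∀ p q, chirality N p q = 0) → ∀ p q, chirality A p q = 0 := fun h p q => by
    rw [hq', h, mul_zero]
  fin_cases i
  · exact ⟨d0 hN.1, q0 hN.2⟩
  · exact ⟨d0 hN.1, q1 hN.2⟩
  · exact ⟨d1 hN.1, q0 hN.2.1, q2 hN.2.2⟩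
  · exact ⟨d1 hN.1, q1 hN.2⟩
  · exact ⟨by rw [hp]; exact mul_pos hr2 hN.1,
      hN.2.imp d2 fun h => ⟨d1 h.1, q3 h.2⟩⟩
  · exact ⟨by rw [hp]; exact mul_neg_of_pos_of_neg hr2 hN.1, d2 hN.2⟩

lemma familyInvariant_of_mem_normalForms {N : Matrix (Fin 4) (Fin 4) ℝ} {i : Fin 6}
    (h : N ∈ normalForms i) : familyInvariant N i := by
  fin_cases i
  · obtain ⟨θ, hs, rfl⟩ := h
    have hs2 : 0 < Real.sin θ ^ 2 := by positivity
    refine ⟨?_, fun p q => ?_⟩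
    · simp [traceDisc, trace, Fin.sum_univ_four]
      nlinarith
    -- With ℝ⁴ = ℂ², the two squares are those of the real and imaginary parts of the complex
    -- determinant of p and q.
    · refine (show 0 ≤ Real.sin θ ^ 2 *
          ((p 0 * q 2 - p 1 * q 3 - p 2 * q 0 + p 3 * q 1) ^ 2 +
           (p 0 * q 3 + p 1 * q 2 - p 2 * q 1 - p 3 * q 0) ^ 2) by positivity).trans_eq ?_
      rw [chirality, det_columns]
      simp [mulVec, dotProduct, Fin.sum_univ_four]
      ring
  · obtain ⟨θ, hs, rfl⟩ := h
    have hs2 : 0 < Real.sin θ ^ 2 := by positivity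
    refine ⟨?_, ![1, 0, 0, 0], ![0, 0, 1, 0], ?_⟩
    · simp [traceDisc, trace, Fin.sum_univ_four]
      nlinarith
    · rw [chirality, det_columns]
      simp [mulVec, dotProduct, Fin.sum_univ_four]
      nlinarith
  · obtain ⟨l, hl, rfl⟩ := h
    have hl2 : 0 < l ^ 2 := by positivity
    refine ⟨?_, fun p q => ?_, ![0, 1, 0, 0], ![0, 0, 1, 0], ?_⟩
    · simp [traceDisc, trace, Fin.sum_univ_four]
      norm_num
    · refine (sq_nonneg (l * (p 1 * q 2 - p 2 * q 1))).trans_eq ?_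
      rw [chirality, det_columns]
      simp [mulVec, dotProduct, Fin.sum_univ_four]
      ring
    · rw [chirality, det_columns]
      simp [mulVec, dotProduct, Fin.sum_univ_four]
      nlinarith
  · obtain ⟨l, hl, rfl⟩ := h
    have hl2 : 0 < l ^ 2 := by positivity
    refine ⟨?_, ![0, 1, 0, 0], ![0, 0, 1, 0], ?_⟩
    · simp [traceDisc, trace, Fin.sum_univ_four]
      norm_num
    · rw [chirality, det_columns]
      simp [mulVec, dotProduct, Fin.sum_univ_four]
      nlinarith
  · obtain ⟨l, hl, rfl⟩ := h
    have hd : traceDisc (diagonal ![l⁻¹, l⁻¹, l, l]) = 4 * (l⁻¹ - l) ^ 2 := by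
      simp [traceDisc, trace, Fin.sum_univ_four]
      ring
    refine ⟨?_, ?_⟩
    · have : traceProd (diagonal ![l⁻¹, l⁻¹, l, l]) = 8 * (l⁻¹ * l) := by
        simp only [traceProd, trace, diagonal_mul_diagonal, Fin.sum_univ_four, diag_diagonal]
        simp
        ring
      rw [this]; positivity
    · rw [hd]
      rcases eq_or_ne l⁻¹ l with h | h
      · refine Or.inr ⟨by rw [h]; ring, fun p q => ?_⟩
        rw [h, chirality, det_columns]
        simp [mulVec, dotProduct, Fin.sum_univ_four]
        ring
      · have := sub_ne_zero.2 h
        exact Or.inl (by positivity)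
  · obtain ⟨l, hl, rfl⟩ := h
    refine ⟨?_, ?_⟩
    · have : traceProd (diagonal ![l⁻¹, l⁻¹, -l, -l]) = -(8 * (l⁻¹ * l)) := by
        simp only [traceProd, trace, diagonal_mul_diagonal, Fin.sum_univ_four, diag_diagonal]
        simp
        ring
      rw [this, neg_lt_zero]; positivity
    · have : traceDisc (diagonal ![l⁻¹, l⁻¹, -l, -l]) = 4 * (l⁻¹ + l) ^ 2 := by
        simp [traceDisc, trace, Fin.sum_univ_four]
        ring
      rw [this]; positivity

lemma HasNormalForm.unique {A : SL4} {i j : Fin 6} (hi : HasNormalForm A i)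
    (hj : HasNormalForm A j) : i = j := by
  obtain ⟨N, hN, h⟩ := hi
  obtain ⟨N', hN', h'⟩ := hj
  exact familyInvariant_unique
    (familyInvariant_of_conj h (familyInvariant_of_mem_normalForms hN))
    (familyInvariant_of_conj h' (familyInvariant_of_mem_normalForms hN'))

/-! ### Bases that realise the normal forms -/

/-- Scaling C by its determinant to the power -1/4 puts it in SL(4) without changing the
conjugation, so only the orientation of the basis matters. -/
lemma isConjUpToScale_of_det_pos {A N C : Matrix (Fin 4) (Fin 4) ℝ} {r : ℝ} (hr : r ≠ 0)
    (hC : 0 < C.det) (h : A * C = r • (C * N)) : IsConjUpToScale A N := by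
  have ht : 0 < C.det ^ (-(1 / 4) : ℝ) := Real.rpow_pos_of_pos hC _
  have ht4 : (C.det ^ (-(1 / 4) : ℝ)) ^ 4 * C.det = 1 := by
    rw [← Real.rpow_natCast, ← Real.rpow_mul hC.le]
    norm_num
    rw [Real.rpow_neg_one, inv_mul_cancel₀ hC.ne']
  set t := C.det ^ (-(1 / 4) : ℝ)
  let C' : SL4 := ⟨t • C, by rw [det_smul, Fintype.card_fin, ht4]⟩
  refine ⟨r, hr, C', ?_⟩
  have e : C'.1 * (C'⁻¹ : SL4).1 = 1 := congrArg Subtype.val (mul_inv_cancel C')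
  calc A = A * (C'.1 * (C'⁻¹ : SL4).1) := by rw [e, mul_one]
    _ = t • (A * C) * (C'⁻¹ : SL4).1 := by
      rw [← mul_assoc, show C'.1 = t • C from rfl, mul_smul_comm]
    _ = _ := by
      rw [h, smul_comm, smul_mul_assoc, show C'.1 = t • C from rfl, smul_mul_assoc t C N]

lemma columns_mul (a b c d : Fin 4 → ℝ) (N : Matrix (Fin 4) (Fin 4) ℝ) :
    columns a b c d * N = columns
      (N 0 0 • a + N 1 0 • b + N 2 0 • c + N 3 0 • d)
      (N 0 1 • a + N 1 1 • b + N 2 1 • c + N 3 1 • d)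
      (N 0 2 • a + N 1 2 • b + N 2 2 • c + N 3 2 • d)
      (N 0 3 • a + N 1 3 • b + N 2 3 • c + N 3 3 • d) := by
  ext i j
  fin_cases j <;> simp [columns, mul_apply, Fin.sum_univ_four] <;> ring

lemma smul_columns (r : ℝ) (a b c d : Fin 4 → ℝ) :
    r • columns a b c d = columns (r • a) (r • b) (r • c) (r • d) := by
  ext i j
  fin_cases j <;> rfl

section

variable {A J : Matrix (Fin 4) (Fin 4) ℝ} {m n k : ℝ}

lemma smul_one_add_smul_mulVec (p : Fin 4 → ℝ) :
    (m • (1 : Matrix (Fin 4) (Fin 4) ℝ) + n • J) *ᵥ p = m • p + n • (J *ᵥ p) := by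
  rw [add_mulVec, smul_mulVec, smul_mulVec, one_mulVec]

lemma mulVec_mulVec_of_mul_self (hJ : J * J = k • (1 : Matrix (Fin 4) (Fin 4) ℝ))
    (p : Fin 4 → ℝ) : J *ᵥ (J *ᵥ p) = k • p := by
  rw [mulVec_mulVec, hJ, smul_mulVec, one_mulVec]

lemma exists_polar (hn : n ≠ 0) : ∃ r θ : ℝ, r ≠ 0 ∧ Real.sin θ ≠ 0 ∧
    m = r * Real.cos θ ∧ n = r * Real.sin θ := by
  have h : (⟨m, n⟩ : ℂ) ≠ 0 := fun h => hn (congrArg Complex.im h)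
  have hr := norm_ne_zero_iff.2 h
  refine ⟨‖(⟨m, n⟩ : ℂ)‖, Complex.arg ⟨m, n⟩, hr, ?_, ?_, ?_⟩
  · rw [Complex.sin_arg]; exact div_ne_zero hn hr
  · rw [Complex.norm_mul_cos_arg]
  · rw [Complex.norm_mul_sin_arg]

lemma isConjUpToScale_rotation_of_chirality_pos (hn : n ≠ 0)
    (hJ : J * J = (-1 : ℝ) • (1 : Matrix (Fin 4) (Fin 4) ℝ)) {p q : Fin 4 → ℝ}
    (h : 0 < chirality J p q) (hA : A = m • (1 : Matrix (Fin 4) (Fin 4) ℝ) + n • J) :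
    ∃ N ∈ normalForms 0, IsConjUpToScale A N := by
  obtain ⟨r, θ, hr, hs, rfl, rfl⟩ := exists_polar (m := m) hn
  refine ⟨_, ⟨θ, hs, rfl⟩, isConjUpToScale_of_det_pos hr h ?_⟩
  rw [hA, mul_columns, columns_mul, smul_columns]
  simp only [smul_one_add_smul_mulVec, mulVec_mulVec_of_mul_self hJ]
  simp
  congr 1 <;> module

lemma isConjUpToScale_rotation_of_chirality_neg (hn : n ≠ 0)
    (hJ : J * J = (-1 : ℝ) • (1 : Matrix (Fin 4) (Fin 4) ℝ)) {p q : Fin 4 → ℝ}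
    (h : chirality J p q < 0) (hA : A = m • (1 : Matrix (Fin 4) (Fin 4) ℝ) + n • J) :
    ∃ N ∈ normalForms 1, IsConjUpToScale A N := by
  obtain ⟨r, θ, hr, hs, rfl, rfl⟩ := exists_polar (m := m) hn
  -- Exchanging p and Jp makes the basis positive and reverses the first rotation block.
  refine ⟨_, ⟨θ, hs, rfl⟩, isConjUpToScale_of_det_pos (C := columns (J *ᵥ p) p q (J *ᵥ q)) hr ?_ ?_⟩
  · rw [chirality, det_columns] at h
    rw [det_columns]
    linarith
  · rw [hA, mul_columns, columns_mul, smul_columns]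
    simp only [smul_one_add_smul_mulVec, mulVec_mulVec_of_mul_self hJ]
    simp
    congr 1 <;> module

lemma isConjUpToScale_shear_of_chirality_pos (hm : m ≠ 0) (hn : n ≠ 0)
    (hJ : J * J = (0 : ℝ) • (1 : Matrix (Fin 4) (Fin 4) ℝ)) {p q : Fin 4 → ℝ}
    (h : 0 < chirality J p q) (hA : A = m • (1 : Matrix (Fin 4) (Fin 4) ℝ) + n • J) :
    ∃ N ∈ normalForms 2, IsConjUpToScale A N := by
  obtain ⟨l, rfl⟩ : ∃ l, n = m * l := ⟨n / m, by field_simp⟩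
  refine ⟨_, ⟨l, right_ne_zero_of_mul hn, rfl⟩,
    isConjUpToScale_of_det_pos (C := columns (-(J *ᵥ p)) p q (J *ᵥ q)) hm ?_ ?_⟩
  · rw [chirality, det_columns] at h
    simp only [det_columns, Pi.neg_apply]
    linarith
  · rw [hA, mul_columns, columns_mul, smul_columns]
    simp only [smul_one_add_smul_mulVec, mulVec_neg, mulVec_mulVec_of_mul_self hJ]
    simp
    congr 1 <;> module

lemma isConjUpToScale_shear_of_chirality_neg (hm : m ≠ 0) (hn : n ≠ 0)
    (hJ : J * J = (0 : ℝ) • (1 : Matrix (Fin 4) (Fin 4) ℝ)) {p q : Fin 4 → ℝ}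
    (h : chirality J p q < 0) (hA : A = m • (1 : Matrix (Fin 4) (Fin 4) ℝ) + n • J) :
    ∃ N ∈ normalForms 3, IsConjUpToScale A N := by
  obtain ⟨l, rfl⟩ : ∃ l, n = m * l := ⟨n / m, by field_simp⟩
  refine ⟨_, ⟨l, right_ne_zero_of_mul hn, rfl⟩,
    isConjUpToScale_of_det_pos (C := columns (J *ᵥ p) p q (J *ᵥ q)) hm ?_ ?_⟩
  · rw [chirality, det_columns] at h
    rw [det_columns]
    linarith
  · rw [hA, mul_columns, columns_mul, smul_columns]
    simp only [smul_one_add_smul_mulVec, mulVec_mulVec_of_mul_self hJ]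
    simp
    congr 1 <;> module

lemma exists_columns_mul_eq_of_chirality_ne_zero
    (hJ : J * J = (1 : ℝ) • (1 : Matrix (Fin 4) (Fin 4) ℝ)) {p q : Fin 4 → ℝ}
    (h : chirality J p q ≠ 0) (hA : A = m • (1 : Matrix (Fin 4) (Fin 4) ℝ) + n • J) :
    ∃ C : Matrix (Fin 4) (Fin 4) ℝ, 0 < C.det ∧
      A * C = C * diagonal ![m + n, m + n, m - n, m - n] := by
  -- Eigenvectors of J for 1, 1, -1, -1. Unscaled they have determinant -4χ, where χ is the
  -- chirality; the factor -χ on the first makes it 4χ², so both orientations lead to the same form.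
  refine ⟨columns ((-chirality J p q) • (p + J *ᵥ p)) (q + J *ᵥ q) (p - J *ᵥ p) (q - J *ᵥ q), ?_, ?_⟩
  · have h2 : 0 < 4 * chirality J p q ^ 2 := by positivity
    refine h2.trans_eq ?_
    rw [pow_two, ← mul_assoc]
    generalize hc : 4 * chirality J p q = c
    rw [chirality, det_columns] at hc ⊢
    subst hc
    simp only [det_columns, Pi.smul_apply, Pi.add_apply, Pi.sub_apply, smul_eq_mul]
    ring
  · rw [hA, mul_columns, columns_mul]
    simp only [smul_one_add_smul_mulVec, mulVec_smul, mulVec_add, mulVec_sub,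
      mulVec_mulVec_of_mul_self hJ]
    simp
    congr 1 <;> module

lemma isConjUpToScale_diagonal_of_pos {C : Matrix (Fin 4) (Fin 4) ℝ} {a b : ℝ} (hab : 0 < a * b)
    (hC : 0 < C.det) (h : A * C = C * diagonal ![a, a, b, b]) :
    ∃ N ∈ normalForms 4, IsConjUpToScale A N := by
  -- The scale satisfies r² = ab and takes the common sign of a and b, so that l = b/r is positive.
  obtain ⟨r, l, hr, hl, ha, hb⟩ : ∃ r l : ℝ, r ≠ 0 ∧ 0 < l ∧ a = r * l⁻¹ ∧ b = r * l := by
    have hs := Real.sqrt_pos.2 hab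
    have hss := Real.mul_self_sqrt hab.le
    generalize √(a * b) = s at hs hss
    rcases pos_and_pos_or_neg_and_neg_of_mul_pos hab with ⟨h1, h2⟩ | ⟨h1, h2⟩
    · refine ⟨s, b / s, hs.ne', by positivity, ?_, ?_⟩ <;> field_simp
      linarith
    · refine ⟨-s, -b / s, by linarith, div_pos (by linarith) hs, ?_, ?_⟩
      · have := h2.ne
        field_simp
        linarith
      · field_simp
  refine ⟨_, ⟨l, hl, rfl⟩, isConjUpToScale_of_det_pos hr hC ?_⟩
  rw [h, ← mul_smul_comm, ← diagonal_smul]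
  congr 2
  ext i; fin_cases i <;> simp [ha, hb]

lemma isConjUpToScale_diagonal_of_neg {C : Matrix (Fin 4) (Fin 4) ℝ} {a b : ℝ} (hab : a * b < 0)
    (hC : 0 < C.det) (h : A * C = C * diagonal ![a, a, b, b]) :
    ∃ N ∈ normalForms 5, IsConjUpToScale A N := by
  obtain ⟨r, l, hr, hl, ha, hb⟩ : ∃ r l : ℝ, r ≠ 0 ∧ 0 < l ∧ a = r * l⁻¹ ∧ b = r * -l := by
    have hab' : 0 < -(a * b) := by linarith
    have hs := Real.sqrt_pos.2 hab'
    have hss := Real.mul_self_sqrt hab'.le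
    generalize √(-(a * b)) = s at hs hss
    rcases mul_neg_iff.1 hab with ⟨h1, h2⟩ | ⟨h1, h2⟩
    · refine ⟨s, -b / s, hs.ne', div_pos (by linarith) hs, ?_, ?_⟩
      · have := h2.ne
        field_simp
        linarith
      · field_simp
    · refine ⟨-s, b / s, by linarith, div_pos (by linarith) hs, ?_, ?_⟩
      · have := h2.ne'
        field_simp
        linarith
      · field_simp
  refine ⟨_, ⟨l, hl, rfl⟩, isConjUpToScale_of_det_pos hr hC ?_⟩
  rw [h, ← mul_smul_comm, ← diagonal_smul]
  congr 2
  ext i; fin_cases i <;> simp [ha, hb]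

end

/-- Passes from a basis of the subtype to a pair of ambient vectors; `e` records which of the two
carries which sign. -/
lemma hasSignature_iff {W : Submodule ℝ ScrewSpace} {p q r : ℕ}
    (e : Fin 2 ≃ Fin p ⊕ Fin q ⊕ Fin r) :
    HasSignature W p q r ↔ ∃ v : Fin 2 → ScrewSpace, LinearIndependent ℝ v ∧
      Submodule.span ℝ (Set.range v) = W ∧ screwInner (v 0) (v 1) = 0 ∧
      ∀ i, screwInner (v i) (v i) =
        Sum.elim (fun _ => 1) (Sum.elim (fun _ => -1) (fun _ => 0)) (e i) := by
  constructor
  · rintro ⟨b, ho, h1, h2, h3⟩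
    refine ⟨fun i => b (e i), ?_, ?_, ho _ _ (e.injective.ne (by decide)), fun i => ?_⟩
    · exact (b.linearIndependent.map' W.subtype W.ker_subtype).comp e e.injective
    · have := congrArg (Submodule.map W.subtype) b.span_eq
      rw [Submodule.map_span, Submodule.map_top, Submodule.range_subtype, ← Set.range_comp] at this
      rw [← e.surjective.range_comp] at this
      exact this
    · show screwInner (b (e i)) (b (e i)) = _
      rcases e i with i | i | i
      exacts [h1 i, h2 i, h3 i]
  · rintro ⟨v, hv, rfl, ho, h⟩
    have hb : ∀ i, ((Module.Basis.span hv).reindex e i : ScrewSpace) = v (e.symm i) := fun i => by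
      rw [Module.Basis.reindex_apply, Module.Basis.span_apply]
    refine ⟨(Module.Basis.span hv).reindex e, ?_, ?_, ?_, ?_⟩
    · intro i j hij
      rw [hb, hb]
      have hij' := e.symm.injective.ne hij
      revert hij'
      generalize e.symm i = i'
      generalize e.symm j = j'
      intro hij'
      fin_cases i' <;> fin_cases j'
      exacts [absurd rfl hij', ho, (screwInner_comm _ _).trans ho, absurd rfl hij']
    all_goals
      intro i
      rw [hb, h]
      simp

/-! ### Decomposition along an orthogonal basis, and the sign of the chirality -/

section

variable {U V X Y : ScrewSpace}

/-- Expanding P(aX+bY)D(cX+dY), the diagonal terms are scalars and the cross terms anticommute,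
leaving (ad - bc)P(X)D(Y). The quadratic relation is Brahmagupta's identity for the product
⟨U,U⟩⟨V,V⟩. -/
lemma exists_decomposition {A : Matrix (Fin 4) (Fin 4) ℝ} {r : ℝ} (hr : r ≠ 0)
    (hXY : screwInner X Y = 0) (hUV : LinearIndependent ℝ ![U, V])
    (hU : U ∈ Submodule.span ℝ {X, Y}) (hV : V ∈ Submodule.span ℝ {X, Y})
    (hA : A = r • (pluckerMatrix U * dualMatrix V)) :
    ∃ m n : ℝ, n ≠ 0 ∧
      4 * (m ^ 2 + n ^ 2 * (screwInner X X * screwInner Y Y)) =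
        r ^ 2 * (screwInner U U * screwInner V V) ∧
      A = m • (1 : Matrix (Fin 4) (Fin 4) ℝ) +
        n • ((2 : ℝ) • (pluckerMatrix X * dualMatrix Y)) := by
  obtain ⟨a, b, rfl⟩ := Submodule.mem_span_pair.1 hU
  obtain ⟨c, d, rfl⟩ := Submodule.mem_span_pair.1 hV
  rw [LinearIndependent.pair_iff] at hUV
  have hdet : a * d - b * c ≠ 0 := by
    intro h
    have h1 := hUV d (-b) (by
      rw [show d • (a • X + b • Y) + -b • (c • X + d • Y) = (a * d - b * c) • X by module, h,
        zero_smul])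
    have h2 := hUV (-c) a (by
      rw [show -c • (a • X + b • Y) + a • (c • X + d • Y) = (a * d - b * c) • Y by module, h,
        zero_smul])
    have h3 := hUV 1 0 (by rw [h2.2, neg_eq_zero.1 h1.2]; simp)
    exact one_ne_zero h3.1
  have hYX : screwInner Y X = 0 := by rw [screwInner_comm, hXY]
  refine ⟨-r * (a * c * screwInner X X + b * d * screwInner Y Y) / 2,
    r * (a * d - b * c) / 2, by positivity, ?_, ?_⟩
  · simp only [screwInner_add_left, screwInner_add_right, screwInner_smul_left,
      screwInner_smul_right, hXY, hYX]
    ring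
  · have hc := pluckerMatrix_mul_dualMatrix_add X Y
    rw [hXY, neg_zero, zero_smul, ← eq_neg_iff_add_eq_zero, eq_neg_iff_add_eq_zero, add_comm,
      ← eq_neg_iff_add_eq_zero] at hc
    rw [hA, pluckerMatrix_add, dualMatrix_add]
    simp only [pluckerMatrix_smul, dualMatrix_smul, add_mul, mul_add, smul_mul_assoc,
      mul_smul_comm, pluckerMatrix_mul_dualMatrix_self, hc]
    module

lemma two_smul_mul_self (hXY : screwInner X Y = 0) :
    ((2 : ℝ) • (pluckerMatrix X * dualMatrix Y)) * ((2 : ℝ) • (pluckerMatrix X * dualMatrix Y)) =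
      (-(screwInner X X * screwInner Y Y)) • (1 : Matrix (Fin 4) (Fin 4) ℝ) := by
  have hc := dualMatrix_mul_pluckerMatrix_add X Y
  rw [hXY, neg_zero, zero_smul, add_comm, ← eq_neg_iff_add_eq_zero] at hc
  rw [smul_mul_smul_comm, mul_assoc, ← mul_assoc (dualMatrix Y), hc, neg_mul, mul_assoc, mul_neg,
    ← mul_assoc (pluckerMatrix X), pluckerMatrix_mul_dualMatrix_self,
    pluckerMatrix_mul_dualMatrix_self, smul_mul_smul_comm, mul_one]
  module

/-- The Pfaffian identity computing a determinant from a skew-symmetric form. -/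
lemma screwInner_mul_det_columns (Y : ScrewSpace) (a b c d : Fin 4 → ℝ) :
    screwInner Y Y / 2 * (columns a b c d).det =
      (a ⬝ᵥ dualMatrix Y *ᵥ b) * (c ⬝ᵥ dualMatrix Y *ᵥ d) -
      (a ⬝ᵥ dualMatrix Y *ᵥ c) * (b ⬝ᵥ dualMatrix Y *ᵥ d) +
      (a ⬝ᵥ dualMatrix Y *ᵥ d) * (b ⬝ᵥ dualMatrix Y *ᵥ c) := by
  rw [det_columns]
  simp [screwInner_eq, dualMatrix, pluckerMatrix, dotProduct, mulVec, Fin.sum_univ_four]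
  ring

lemma dotProduct_mulVec_self_of_transpose {M : Matrix (Fin 4) (Fin 4) ℝ} (h : Mᵀ = -M)
    (p : Fin 4 → ℝ) : p ⬝ᵥ M *ᵥ p = 0 := by
  have e : p ⬝ᵥ M *ᵥ p = p ⬝ᵥ Mᵀ *ᵥ p := by
    rw [dotProduct_mulVec, ← mulVec_transpose, dotProduct_comm]
  rw [h, neg_mulVec, dotProduct_neg] at e
  linarith

/-- Apply the Pfaffian identity to p, Jp, q, Jq. Since D(Y)J is skew, J is self-adjoint for the form
D(Y); hence p and Jp pair to zero, the pairings of p with Jq and of Jp with q agree, and J² is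
scalar in the remaining term. -/
lemma screwInner_mul_chirality (hXY : screwInner X Y = 0) (p q : Fin 4 → ℝ) :
    screwInner Y Y / 2 * chirality ((2 : ℝ) • (pluckerMatrix X * dualMatrix Y)) p q =
      (p ⬝ᵥ (dualMatrix Y * ((2 : ℝ) • (pluckerMatrix X * dualMatrix Y))) *ᵥ q) ^ 2 +
      screwInner X X * screwInner Y Y * (p ⬝ᵥ dualMatrix Y *ᵥ q) ^ 2 := by
  have hJJ := two_smul_mul_self hXY
  have hE : (dualMatrix Y * ((2 : ℝ) • (pluckerMatrix X * dualMatrix Y)))ᵀ =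
      -(dualMatrix Y * ((2 : ℝ) • (pluckerMatrix X * dualMatrix Y))) := by
    simp only [transpose_mul, transpose_smul, pluckerMatrix_transpose, dualMatrix_transpose]
    simp [mul_assoc]
  have hD := dualMatrix_transpose Y
  rw [chirality, screwInner_mul_det_columns]
  generalize (2 : ℝ) • (pluckerMatrix X * dualMatrix Y) = J at *
  have hJE : Jᵀ * dualMatrix Y = dualMatrix Y * J := by
    rw [transpose_mul, hD, mul_neg, neg_inj] at hE
    exact hE
  have mv : ∀ a b, (J *ᵥ a) ⬝ᵥ b = a ⬝ᵥ Jᵀ *ᵥ b := fun a b => by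
    rw [dotProduct_comm, dotProduct_mulVec, ← mulVec_transpose, dotProduct_comm]
  simp only [mv, mulVec_mulVec, ← mul_assoc, hJE, dotProduct_mulVec_self_of_transpose hE]
  rw [mul_assoc, hJJ, mul_smul_comm, mul_one, smul_mulVec, dotProduct_smul, smul_eq_mul]
  ring

lemma exists_dotProduct_mulVec_ne_zero {M : Matrix (Fin 4) (Fin 4) ℝ} (h : M ≠ 0) :
    ∃ p q, p ⬝ᵥ M *ᵥ q ≠ 0 := by
  contrapose! h
  ext i j
  simpa using h (Pi.single i 1) (Pi.single j 1)

lemma dualMatrix_ne_zero (hY : screwInner Y Y ≠ 0) : dualMatrix Y ≠ 0 := fun h => by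
  have := det_dualMatrix Y
  rw [h, det_zero] at this
  apply hY
  nlinarith

lemma exists_chirality_ne_zero_of_degenerate (hXY : screwInner X Y = 0) (hX : X ≠ 0)
    (hY : screwInner Y Y ≠ 0) (hXX : screwInner X X = 0) :
    ∃ p q, chirality ((2 : ℝ) • (pluckerMatrix X * dualMatrix Y)) p q ≠ 0 := by
  -- D(Y) is invertible, so D(Y)P(X)D(Y) = 0 would force X = 0.
  have hE : dualMatrix Y * ((2 : ℝ) • (pluckerMatrix X * dualMatrix Y)) ≠ 0 := by
    intro h
    have hdet : IsUnit (dualMatrix Y).det := by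
      rw [det_dualMatrix]; exact (by positivity : _ ≠ (0:ℝ)).isUnit
    apply hX
    apply pluckerMatrix_injective
    have h' := congrArg (fun M => (dualMatrix Y)⁻¹ * M * (dualMatrix Y)⁻¹) h
    simp only [mul_smul_comm, smul_mul_assoc, nonsing_inv_mul_cancel_left _ _ hdet,
      mul_nonsing_inv_cancel_right _ _ hdet, mul_zero, zero_mul, smul_eq_zero] at h'
    rw [h'.resolve_left two_ne_zero]
    ext i j; fin_cases i <;> fin_cases j <;> simp [pluckerMatrix]
  obtain ⟨p, q, h⟩ := exists_dotProduct_mulVec_ne_zero hE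
  refine ⟨p, q, fun h0 => ?_⟩
  have := screwInner_mul_chirality hXY p q
  rw [h0, hXX] at this
  apply h
  nlinarith

lemma exists_chirality_ne_zero_of_definite (hXY : screwInner X Y = 0)
    (hg : 0 < screwInner X X * screwInner Y Y) :
    ∃ p q, chirality ((2 : ℝ) • (pluckerMatrix X * dualMatrix Y)) p q ≠ 0 := by
  obtain ⟨p, q, h⟩ := exists_dotProduct_mulVec_ne_zero
    (dualMatrix_ne_zero (right_ne_zero_of_mul hg.ne'))
  refine ⟨p, q, fun h0 => ?_⟩
  have := screwInner_mul_chirality hXY p q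
  rw [h0, mul_zero] at this
  have h1 : 0 < (p ⬝ᵥ dualMatrix Y *ᵥ q) ^ 2 := by positivity
  nlinarith [mul_pos hg h1]

lemma trace_pluckerMatrix_mul_dualMatrix (X Y : ScrewSpace) :
    (pluckerMatrix X * dualMatrix Y).trace = -2 * screwInner X Y := by
  simp [pluckerMatrix, dualMatrix, screwInner_eq, trace, Fin.sum_univ_four]
  ring

lemma eq_zero_or_eq_zero_of_forall_dotProduct_mul {u v : Fin 4 → ℝ}
    (h : ∀ p, (p ⬝ᵥ u) * (p ⬝ᵥ v) = 0) : u = 0 ∨ v = 0 := by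
  by_contra! hne
  have hu : u ⬝ᵥ u ≠ 0 := fun h => hne.1 (dotProduct_self_eq_zero.1 h)
  have hv : v ⬝ᵥ v ≠ 0 := fun h => hne.2 (dotProduct_self_eq_zero.1 h)
  have h1 : u ⬝ᵥ v = 0 := (mul_eq_zero.1 (h u)).resolve_left hu
  have h2 := h (u + v)
  rw [add_dotProduct, add_dotProduct, dotProduct_comm v u, h1, add_zero, zero_add] at h2
  exact mul_ne_zero hu hv h2

/-- If the chirality vanished, the identity would factor as a product of two linear forms in p,
giving Jq = ±q for each q. Then J is scalar, and trace zero makes it 0, against J² = I. -/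
lemma exists_chirality_ne_zero_of_indefinite (hXY : screwInner X Y = 0)
    (hg : screwInner X X * screwInner Y Y = -1) :
    ∃ p q, chirality ((2 : ℝ) • (pluckerMatrix X * dualMatrix Y)) p q ≠ 0 := by
  by_contra! h0
  have hY : screwInner Y Y ≠ 0 := right_ne_zero_of_mul (by rw [hg]; norm_num)
  have hJJ := two_smul_mul_self hXY
  have key := screwInner_mul_chirality hXY
  have htr : ((2 : ℝ) • (pluckerMatrix X * dualMatrix Y)).trace = 0 := by
    rw [trace_smul, trace_pluckerMatrix_mul_dualMatrix, hXY, mul_zero, smul_zero]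
  have hdet : IsUnit (dualMatrix Y).det := by
    rw [det_dualMatrix]; exact (by positivity : _ ≠ (0:ℝ)).isUnit
  simp only [h0, hg] at key hJJ
  generalize (2 : ℝ) • (pluckerMatrix X * dualMatrix Y) = J at *
  obtain ⟨c, rfl⟩ := exists_eq_smul_one_of_forall_mulVec (T := J) (by
    intro q i j
    have inj : ∀ v, dualMatrix Y *ᵥ v = 0 → v = 0 := fun v hv => by
      have := congrArg ((dualMatrix Y)⁻¹ *ᵥ ·) hv
      simpa [nonsing_inv_mul _ hdet] using this
    have := eq_zero_or_eq_zero_of_forall_dotProduct_mul (u := dualMatrix Y *ᵥ (J *ᵥ q - q))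
      (v := dualMatrix Y *ᵥ (J *ᵥ q + q)) (fun p => by
        rw [mulVec_sub, mulVec_add, dotProduct_sub, dotProduct_add, mulVec_mulVec]
        linear_combination -key p q)
    rcases this with h | h
    · rw [sub_eq_zero.1 (inj _ h), mul_comm]
    · rw [eq_neg_of_add_eq_zero_left (inj _ h)]
      simp [mul_comm])
  rw [trace_smul, trace_one] at htr
  have hc : c = 0 := by simpa using htr
  have := congrFun (congrFun hJJ 0) 0
  simp [hc] at this

end

/-! ### From the signature of the plane to the family -/

section

variable {A : SL4} {U V X Y : ScrewSpace}

lemma hasNormalForm_of_orthogonal {r : ℝ} (hr : r ≠ 0) (hU : screwInner U U ≠ 0)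
    (hV : screwInner V V ≠ 0) (hUV : LinearIndependent ℝ ![U, V])
    (hXY : LinearIndependent ℝ ![X, Y]) (ho : screwInner X Y = 0)
    (hW : Submodule.span ℝ {X, Y} = Submodule.span ℝ {U, V})
    (hA : (A : Matrix (Fin 4) (Fin 4) ℝ) = r • (pluckerMatrix U * dualMatrix V)) :
    (screwInner X X = 1 → screwInner Y Y = 1 → HasNormalForm A 0) ∧
    (screwInner X X = -1 → screwInner Y Y = -1 → HasNormalForm A 1) ∧
    (screwInner X X = 0 → screwInner Y Y = 1 → HasNormalForm A 2) ∧
    (screwInner X X = 0 → screwInner Y Y = -1 → HasNormalForm A 3) ∧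
    (screwInner X X = 1 → screwInner Y Y = -1 → 0 < screwInner U U * screwInner V V →
      HasNormalForm A 4) ∧
    (screwInner X X = 1 → screwInner Y Y = -1 → screwInner U U * screwInner V V < 0 →
      HasNormalForm A 5) := by
  obtain ⟨m, n, hn, hmn, hdec⟩ := exists_decomposition hr ho hUV
    (by rw [hW]; exact Submodule.subset_span (by simp))
    (by rw [hW]; exact Submodule.subset_span (by simp)) hA
  have hJ := two_smul_mul_self ho
  have hQ := screwInner_mul_chirality ho
  have hX0 : X ≠ 0 := hXY.ne_zero 0
  have hr2 : 0 < r ^ 2 := by positivity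
  refine ⟨fun hX hY => ?_, fun hX hY => ?_, fun hX hY => ?_, fun hX hY => ?_,
    fun hX hY hs => ?_, fun hX hY hs => ?_⟩
  · obtain ⟨p, q, h⟩ := exists_chirality_ne_zero_of_definite ho (by rw [hX, hY]; norm_num)
    have h1 := hQ p q
    rw [hX, hY] at hJ h1
    refine isConjUpToScale_rotation_of_chirality_pos hn (by rw [hJ]; norm_num)
      (lt_of_le_of_ne ?_ h.symm) hdec
    nlinarith
  · obtain ⟨p, q, h⟩ := exists_chirality_ne_zero_of_definite ho (by rw [hX, hY]; norm_num)
    have h1 := hQ p q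
    rw [hX, hY] at hJ h1
    refine isConjUpToScale_rotation_of_chirality_neg hn (by rw [hJ]; norm_num)
      (lt_of_le_of_ne ?_ h) hdec
    nlinarith
  · obtain ⟨p, q, h⟩ := exists_chirality_ne_zero_of_degenerate ho hX0 (by rw [hY]; norm_num) hX
    have h1 := hQ p q
    rw [hX, hY] at hJ h1 hmn
    -- With X null, the quadratic relation reads 4m² = r²⟨U,U⟩⟨V,V⟩, which is nonzero.
    have hm : m ≠ 0 := by
      rintro rfl
      exact mul_ne_zero hr2.ne' (mul_ne_zero hU hV) (by linarith)
    refine isConjUpToScale_shear_of_chirality_pos hm hn (by rw [hJ]; norm_num)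
      (lt_of_le_of_ne ?_ h.symm) hdec
    nlinarith
  · obtain ⟨p, q, h⟩ := exists_chirality_ne_zero_of_degenerate ho hX0 (by rw [hY]; norm_num) hX
    have h1 := hQ p q
    rw [hX, hY] at hJ h1 hmn
    have hm : m ≠ 0 := by
      rintro rfl
      exact mul_ne_zero hr2.ne' (mul_ne_zero hU hV) (by linarith)
    refine isConjUpToScale_shear_of_chirality_neg hm hn (by rw [hJ]; norm_num)
      (lt_of_le_of_ne ?_ h) hdec
    nlinarith
  all_goals
    obtain ⟨p, q, h⟩ := exists_chirality_ne_zero_of_indefinite ho (by rw [hX, hY]; norm_num)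
    rw [hX, hY] at hJ hmn
    obtain ⟨C, hC, hAC⟩ := exists_columns_mul_eq_of_chirality_ne_zero (by rw [hJ]; norm_num) h hdec
  -- The eigenvalue product (m + n)(m - n) equals r²⟨U,U⟩⟨V,V⟩/4.
  · exact isConjUpToScale_diagonal_of_pos (by nlinarith [mul_pos hr2 hs]) hC hAC
  · exact isConjUpToScale_diagonal_of_neg
      (by nlinarith [mul_neg_of_pos_of_neg hr2 hs]) hC hAC

/-- The splitting of two indices according to the signs `(+, +)`. -/
def finTwoEquivPlusPlus : Fin 2 ≃ Fin 2 ⊕ Fin 0 ⊕ Fin 0 where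
  toFun := Sum.inl
  invFun := Sum.elim id (Sum.elim finZeroElim finZeroElim)
  left_inv := by decide
  right_inv := by decide

/-- The splitting of two indices according to the signs `(-, -)`. -/
def finTwoEquivMinusMinus : Fin 2 ≃ Fin 0 ⊕ Fin 2 ⊕ Fin 0 where
  toFun i := Sum.inr (Sum.inl i)
  invFun := Sum.elim finZeroElim (Sum.elim id finZeroElim)
  left_inv := by decide
  right_inv := by decide

/-- The splitting of two indices according to the signs `(0, +)`. -/
def finTwoEquivZeroPlus : Fin 2 ≃ Fin 1 ⊕ Fin 0 ⊕ Fin 1 where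
  toFun := ![Sum.inr (Sum.inr 0), Sum.inl 0]
  invFun := Sum.elim (fun _ => 1) (Sum.elim finZeroElim fun _ => 0)
  left_inv := by decide
  right_inv := by decide

/-- The splitting of two indices according to the signs `(0, -)`. -/
def finTwoEquivZeroMinus : Fin 2 ≃ Fin 0 ⊕ Fin 1 ⊕ Fin 1 where
  toFun := ![Sum.inr (Sum.inr 0), Sum.inr (Sum.inl 0)]
  invFun := Sum.elim finZeroElim (Sum.elim (fun _ => 1) fun _ => 0)
  left_inv := by decide
  right_inv := by decide

/-- The splitting of two indices according to the signs `(+, -)`. -/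
def finTwoEquivPlusMinus : Fin 2 ≃ Fin 1 ⊕ Fin 1 ⊕ Fin 0 where
  toFun := ![Sum.inl 0, Sum.inr (Sum.inl 0)]
  invFun := Sum.elim (fun _ => 0) (Sum.elim (fun _ => 1) finZeroElim)
  left_inv := by decide
  right_inv := by decide

lemma hasSignature_iff_pair {W : Submodule ℝ ScrewSpace} {p q r : ℕ}
    (e : Fin 2 ≃ Fin p ⊕ Fin q ⊕ Fin r) :
    HasSignature W p q r ↔ ∃ X Y : ScrewSpace, LinearIndependent ℝ ![X, Y] ∧
      Submodule.span ℝ {X, Y} = W ∧ screwInner X Y = 0 ∧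
      screwInner X X = Sum.elim (fun _ => 1) (Sum.elim (fun _ => -1) (fun _ => 0)) (e 0) ∧
      screwInner Y Y = Sum.elim (fun _ => 1) (Sum.elim (fun _ => -1) (fun _ => 0)) (e 1) := by
  rw [hasSignature_iff e]
  constructor
  · rintro ⟨v, h1, h2, h3, h4⟩
    have hv : v = ![v 0, v 1] := by ext i : 1; fin_cases i <;> rfl
    refine ⟨v 0, v 1, hv ▸ h1, ?_, h3, h4 0, h4 1⟩
    rw [hv, Matrix.range_cons_cons_empty] at h2
    exact h2
  · rintro ⟨X, Y, h1, h2, h3, h4, h5⟩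
    refine ⟨![X, Y], h1, ?_, h3, fun i => ?_⟩
    · rwa [Matrix.range_cons_cons_empty]
    · fin_cases i
      exacts [h4, h5]

lemma exists_sq_mul_eq (g : ℝ) :
    ∃ s : ℝ, s ≠ 0 ∧ (s ^ 2 * g = 1 ∨ s ^ 2 * g = -1 ∨ g = 0) := by
  rcases eq_or_ne g 0 with h | h
  · exact ⟨1, one_ne_zero, Or.inr (Or.inr h)⟩
  · have ha := abs_pos.2 h
    refine ⟨(√|g|)⁻¹, by positivity, ?_⟩
    rw [inv_pow, Real.sq_sqrt ha.le]
    rcases abs_cases g with ⟨h1, _⟩ | ⟨h1, _⟩ <;> rw [h1]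
    · exact Or.inl (inv_mul_cancel₀ h)
    · exact Or.inr (Or.inl (by field_simp))

/-- Gram–Schmidt starting from U, which is not null: Y is U normalised and X comes from the
component of V orthogonal to U, so at most X is null. -/
lemma exists_orthogonal_pair (hU : screwInner U U ≠ 0) (hUV : LinearIndependent ℝ ![U, V]) :
    ∃ X Y : ScrewSpace, LinearIndependent ℝ ![X, Y] ∧
      Submodule.span ℝ {X, Y} = Submodule.span ℝ {U, V} ∧ screwInner X Y = 0 ∧
      (screwInner X X = 1 ∨ screwInner X X = -1 ∨ screwInner X X = 0) ∧
      (screwInner Y Y = 1 ∨ screwInner Y Y = -1) := by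
  obtain ⟨t, ht⟩ : ∃ t : ℝ, screwInner V U = t * screwInner U U :=
    ⟨screwInner V U / screwInner U U, by field_simp⟩
  obtain ⟨s, hs, hsX⟩ := exists_sq_mul_eq (screwInner (V + -t • U) (V + -t • U))
  obtain ⟨s', hs', hsY⟩ := exists_sq_mul_eq (screwInner U U)
  refine ⟨s • (V + -t • U), s' • U, ?_, ?_, ?_, ?_, ?_⟩
  · rw [LinearIndependent.pair_iff] at hUV ⊢
    intro a b h
    obtain ⟨h1, h2⟩ := hUV (b * s' - a * s * t) (a * s) (by rw [← h]; module)
    have ha : a = 0 := (mul_eq_zero.1 h2).resolve_right hs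
    exact ⟨ha, by simpa [ha, hs'] using h1⟩
  · apply le_antisymm <;> rw [Submodule.span_le, Set.insert_subset_iff, Set.singleton_subset_iff] <;>
      constructor <;> rw [SetLike.mem_coe, Submodule.mem_span_pair]
    · exact ⟨s * -t, s, by module⟩
    · exact ⟨s', 0, by module⟩
    · refine ⟨0, s'⁻¹, ?_⟩
      rw [inv_smul_smul₀ hs']; module
    · refine ⟨s⁻¹, t * s'⁻¹, ?_⟩
      rw [inv_smul_smul₀ hs, mul_smul, inv_smul_smul₀ hs']; module
  · rw [screwInner_smul_left, screwInner_smul_right, screwInner_add_left, screwInner_smul_left, ht]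
    ring
  · rw [screwInner_smul_left, screwInner_smul_right, ← mul_assoc, ← pow_two]
    exact hsX.imp_right (Or.imp_right fun h => by rw [h, mul_zero])
  · rw [screwInner_smul_left, screwInner_smul_right, ← mul_assoc, ← pow_two]
    rcases hsY with h | h | h
    exacts [Or.inl h, Or.inr h, absurd h hU]

/-- The signature condition corresponding to the `i`-th family. -/
def signatureCondition (U V : ScrewSpace) : Fin 6 → Prop :=
  ![HasSignature (Submodule.span ℝ {U, V}) 2 0 0,
    HasSignature (Submodule.span ℝ {U, V}) 0 2 0,
    HasSignature (Submodule.span ℝ {U, V}) 1 0 1,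
    HasSignature (Submodule.span ℝ {U, V}) 0 1 1,
    HasSignature (Submodule.span ℝ {U, V}) 1 1 0 ∧ 0 < screwInner U U * screwInner V V,
    HasSignature (Submodule.span ℝ {U, V}) 1 1 0 ∧ screwInner U U * screwInner V V < 0]

lemma exists_signatureCondition (hU : screwInner U U ≠ 0) (hV : screwInner V V ≠ 0)
    (hUV : LinearIndependent ℝ ![U, V]) : ∃ i, signatureCondition U V i := by
  obtain ⟨X, Y, hXY, hW, ho, hX, hY⟩ := exists_orthogonal_pair hU hUV
  have hYX := LinearIndependent.pair_symm_iff.1 hXY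
  have hW' : Submodule.span ℝ {Y, X} = Submodule.span ℝ {U, V} := by rw [Set.pair_comm, hW]
  have ho' : screwInner Y X = 0 := by rw [screwInner_comm, ho]
  have hpm : HasSignature (Submodule.span ℝ {U, V}) 1 1 0 → ∃ i, signatureCondition U V i := by
    intro h
    rcases (mul_ne_zero hU hV).lt_or_gt with hs | hs
    · exact ⟨5, h, hs⟩
    · exact ⟨4, h, hs⟩
  rcases hX with hX | hX | hX <;> rcases hY with hY | hY
  · exact ⟨0, (hasSignature_iff_pair finTwoEquivPlusPlus).2 ⟨X, Y, hXY, hW, ho, hX, hY⟩⟩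
  · exact hpm ((hasSignature_iff_pair finTwoEquivPlusMinus).2 ⟨X, Y, hXY, hW, ho, hX, hY⟩)
  · exact hpm ((hasSignature_iff_pair finTwoEquivPlusMinus).2 ⟨Y, X, hYX, hW', ho', hY, hX⟩)
  · exact ⟨1, (hasSignature_iff_pair finTwoEquivMinusMinus).2 ⟨X, Y, hXY, hW, ho, hX, hY⟩⟩
  · exact ⟨2, (hasSignature_iff_pair finTwoEquivZeroPlus).2 ⟨X, Y, hXY, hW, ho, hX, hY⟩⟩
  · exact ⟨3, (hasSignature_iff_pair finTwoEquivZeroMinus).2 ⟨X, Y, hXY, hW, ho, hX, hY⟩⟩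

lemma hasNormalForm_of_signatureCondition {r : ℝ} (hr : r ≠ 0) (hU : screwInner U U ≠ 0)
    (hV : screwInner V V ≠ 0) (hUV : LinearIndependent ℝ ![U, V])
    (hA : (A : Matrix (Fin 4) (Fin 4) ℝ) = r • (pluckerMatrix U * dualMatrix V)) {i : Fin 6}
    (h : signatureCondition U V i) : HasNormalForm A i := by
  have key := fun X Y hXY ho hW =>
    hasNormalForm_of_orthogonal (A := A) (X := X) (Y := Y) hr hU hV hUV hXY ho hW hA
  fin_cases i
  · obtain ⟨X, Y, h1, h2, h3, h4, h5⟩ := (hasSignature_iff_pair finTwoEquivPlusPlus).1 h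
    exact (key X Y h1 h3 h2).1 h4 h5
  · obtain ⟨X, Y, h1, h2, h3, h4, h5⟩ := (hasSignature_iff_pair finTwoEquivMinusMinus).1 h
    exact (key X Y h1 h3 h2).2.1 h4 h5
  · obtain ⟨X, Y, h1, h2, h3, h4, h5⟩ := (hasSignature_iff_pair finTwoEquivZeroPlus).1 h
    exact (key X Y h1 h3 h2).2.2.1 h4 h5
  · obtain ⟨X, Y, h1, h2, h3, h4, h5⟩ := (hasSignature_iff_pair finTwoEquivZeroMinus).1 h
    exact (key X Y h1 h3 h2).2.2.2.1 h4 h5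
  · obtain ⟨X, Y, h1, h2, h3, h4, h5⟩ := (hasSignature_iff_pair finTwoEquivPlusMinus).1 h.1
    exact (key X Y h1 h3 h2).2.2.2.2.1 h4 h5 h.2
  · obtain ⟨X, Y, h1, h2, h3, h4, h5⟩ := (hasSignature_iff_pair finTwoEquivPlusMinus).1 h.1
    exact (key X Y h1 h3 h2).2.2.2.2.2 h4 h5 h.2

lemma eq_one_or_eq_neg_one_of_eq_smul_one {c : ℝ}
    (h : (A : Matrix (Fin 4) (Fin 4) ℝ) = c • (1 : Matrix (Fin 4) (Fin 4) ℝ)) :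
    (A : Matrix (Fin 4) (Fin 4) ℝ) = 1 ∨ (A : Matrix (Fin 4) (Fin 4) ℝ) = -1 := by
  have hdet := A.2
  rw [h, det_smul, det_one, mul_one, Fintype.card_fin] at hdet
  rcases (pow_eq_one_iff_of_ne_zero four_ne_zero).1 hdet with hc | hc
  · left; rw [h, hc, one_smul]
  · right; rw [h, hc.1, neg_smul, one_smul]

/-- P(U)D(tU) is scalar by the Clifford relation. Conversely, multiplying a scalar A = rP(U)D(V) by
P(V) on the right cancels D(V) and exhibits P(V) as a multiple of P(U). -/
lemma not_linearIndependent_pair_iff_eq_one_or {r : ℝ} (hU : screwInner U U ≠ 0)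
    (hV : screwInner V V ≠ 0)
    (hA : (A : Matrix (Fin 4) (Fin 4) ℝ) = r • (pluckerMatrix U * dualMatrix V)) :
    ¬ LinearIndependent ℝ ![U, V] ↔
      ((A : Matrix (Fin 4) (Fin 4) ℝ) = 1 ∨ (A : Matrix (Fin 4) (Fin 4) ℝ) = -1) := by
  have hU0 : U ≠ 0 := by
    rintro rfl
    simp [screwInner] at hU
  rw [LinearIndependent.pair_iff' hU0]
  push Not
  constructor
  · rintro ⟨t, rfl⟩
    apply eq_one_or_eq_neg_one_of_eq_smul_one (c := r * (t * -(screwInner U U / 2)))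
    rw [hA, dualMatrix_smul, mul_smul_comm, pluckerMatrix_mul_dualMatrix_self, smul_smul, smul_smul,
      mul_assoc]
  · intro h
    obtain ⟨c, hc, h⟩ : ∃ c : ℝ, c ≠ 0 ∧ (A : Matrix (Fin 4) (Fin 4) ℝ) = c • 1 := by
      rcases h with h | h
      · exact ⟨1, one_ne_zero, by rw [h, one_smul]⟩
      · exact ⟨-1, by norm_num, by rw [h, neg_smul, one_smul]⟩
    have e := congrArg (· * pluckerMatrix V) (hA.symm.trans h)
    simp only [smul_mul_assoc, mul_assoc, dualMatrix_mul_pluckerMatrix_self, mul_smul_comm, mul_one,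
      one_mul, smul_smul] at e
    refine ⟨c⁻¹ * (r * -(screwInner V V / 2)), pluckerMatrix_injective ?_⟩
    rw [pluckerMatrix_smul, mul_smul, e, inv_smul_smul₀ hc]

lemma hasNormalForm_of_eq_one_or_eq_neg_one
    (h : (A : Matrix (Fin 4) (Fin 4) ℝ) = 1 ∨ (A : Matrix (Fin 4) (Fin 4) ℝ) = -1) :
    HasNormalForm A 4 := by
  have hN : (diagonal ![(1 : ℝ)⁻¹, 1⁻¹, 1, 1]) = 1 := by
    rw [← diagonal_one]; congr 1; ext i; fin_cases i <;> simp
  refine ⟨_, ⟨1, one_pos, rfl⟩, ?_⟩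
  rw [hN]
  rcases h with h | h
  · exact ⟨1, one_ne_zero, 1, by simp [h]⟩
  · exact ⟨-1, by norm_num, 1, by simp [h]⟩

/-- Some signature condition always holds and yields its family; uniqueness of the family gives the
converse. -/
lemma hasNormalForm_iff_signatureCondition {r : ℝ} (hr : r ≠ 0) (hU : screwInner U U ≠ 0)
    (hV : screwInner V V ≠ 0) (hUV : LinearIndependent ℝ ![U, V])
    (hA : (A : Matrix (Fin 4) (Fin 4) ℝ) = r • (pluckerMatrix U * dualMatrix V)) (i : Fin 6) :
    HasNormalForm A i ↔ signatureCondition U V i := by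
  refine ⟨fun h => ?_, hasNormalForm_of_signatureCondition hr hU hV hUV hA⟩
  obtain ⟨j, hj⟩ := exists_signatureCondition hU hV hUV
  rwa [h.unique (hasNormalForm_of_signatureCondition hr hU hV hUV hA hj)]

lemma exists_hasNormalForm {r : ℝ} (hr : r ≠ 0) (hU : screwInner U U ≠ 0)
    (hV : screwInner V V ≠ 0)
    (hA : (A : Matrix (Fin 4) (Fin 4) ℝ) = r • (pluckerMatrix U * dualMatrix V)) :
    ∃ i, HasNormalForm A i := by
  by_cases hUV : LinearIndependent ℝ ![U, V]
  · obtain ⟨i, hi⟩ := exists_signatureCondition hU hV hUV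
    exact ⟨i, hasNormalForm_of_signatureCondition hr hU hV hUV hA hi⟩
  · exact ⟨4, hasNormalForm_of_eq_one_or_eq_neg_one
      ((not_linearIndependent_pair_iff_eq_one_or hU hV hA).1 hUV)⟩

end

/-! ### Products of two skew-symmetric matrices -/

lemma exists_pluckerMatrix_eq_sqrt_two_smul {K : SL4}
    (hK : Matrix.transpose (K : Matrix (Fin 4) (Fin 4) ℝ) = -(K : Matrix (Fin 4) (Fin 4) ℝ)) :
    ∃ X : ScrewSpace, |screwInner X X| = 1 ∧
      (K : Matrix (Fin 4) (Fin 4) ℝ) = √2 • pluckerMatrix X := by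
  obtain ⟨X, hX⟩ := exists_pluckerMatrix_eq hK
  -- Determinant 1 means (⟨X,X⟩/2)² = 1, so ⟨X,X⟩ = ±2 and division by √2 normalises X.
  have h2 : √2 ≠ 0 := by positivity
  refine ⟨(√2)⁻¹ • X, ?_, by rw [pluckerMatrix_smul, hX, smul_inv_smul₀ h2]⟩
  have hdet := det_pluckerMatrix X
  rw [hX, K.2] at hdet
  rw [screwInner_smul_left, screwInner_smul_right, ← mul_assoc, ← mul_inv,
    Real.mul_self_sqrt zero_le_two, inv_mul_eq_div]
  exact (abs_eq zero_le_one).2 (sq_eq_one_iff.1 hdet.symm)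

theorem mainTheorem6 (A K L : SL4)
    (hK : Matrix.transpose (K : Matrix (Fin 4) (Fin 4) ℝ) = -(K : Matrix (Fin 4) (Fin 4) ℝ))
    (hL : Matrix.transpose (L : Matrix (Fin 4) (Fin 4) ℝ) = -(L : Matrix (Fin 4) (Fin 4) ℝ))
    (hA : A = K * L) :
    (∃! i : Fin 6, HasNormalForm A i) ∧
    (∃ U V : ScrewSpace, |screwInner U U| = 1 ∧ |screwInner V V| = 1 ∧
      IsMatrixRepresentation A (screwReflection U ∘ screwReflection V)) ∧
    (∀ U V : ScrewSpace, screwInner U U ≠ 0 → screwInner V V ≠ 0 →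
      IsMatrixRepresentation A (screwReflection U ∘ screwReflection V) →
      (¬ LinearIndependent ℝ ![U, V] ↔
        ((A : Matrix (Fin 4) (Fin 4) ℝ) = 1 ∨ (A : Matrix (Fin 4) (Fin 4) ℝ) = -1)) ∧
      (LinearIndependent ℝ ![U, V] →
        (HasNormalForm A 0 ↔ HasSignature (Submodule.span ℝ {U, V}) 2 0 0) ∧
        (HasNormalForm A 1 ↔ HasSignature (Submodule.span ℝ {U, V}) 0 2 0) ∧
        (HasNormalForm A 2 ↔ HasSignature (Submodule.span ℝ {U, V}) 1 0 1) ∧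
        (HasNormalForm A 3 ↔ HasSignature (Submodule.span ℝ {U, V}) 0 1 1) ∧
        (HasNormalForm A 4 ↔ HasSignature (Submodule.span ℝ {U, V}) 1 1 0 ∧
          0 < screwInner U U * screwInner V V) ∧
        (HasNormalForm A 5 ↔ HasSignature (Submodule.span ℝ {U, V}) 1 1 0 ∧
          screwInner U U * screwInner V V < 0))) := by
  obtain ⟨X, hX, hKX⟩ := exists_pluckerMatrix_eq_sqrt_two_smul hK
  obtain ⟨Z, hZ, hLZ⟩ := exists_pluckerMatrix_eq_sqrt_two_smul hL
  -- The swap turns the Plücker matrix of L into a dual matrix, so that KL takes the form 2P(X)D(Y).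
  obtain ⟨Y, rfl⟩ : ∃ Y : ScrewSpace, Y.swap = Z := ⟨Z.swap, Prod.swap_swap Z⟩
  rw [screwInner_swap] at hZ
  have hX0 : screwInner X X ≠ 0 := fun h => by simp [h] at hX
  have hY0 : screwInner Y Y ≠ 0 := fun h => by simp [h] at hZ
  have hAXY : (A : Matrix (Fin 4) (Fin 4) ℝ) = (2 : ℝ) • (pluckerMatrix X * dualMatrix Y) := by
    rw [hA, Matrix.SpecialLinearGroup.coe_mul, hKX, hLZ, smul_mul_smul_comm,
      Real.mul_self_sqrt zero_le_two, dualMatrix]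
  refine ⟨?_, ⟨X, Y, hX, hZ,
    (isMatrixRepresentation_iff A hX0 hY0).2 ⟨2, two_ne_zero, hAXY⟩⟩, fun U V hU hV h => ?_⟩
  · obtain ⟨i, hi⟩ := exists_hasNormalForm two_ne_zero hX0 hY0 hAXY
    exact ⟨i, hi, fun j hj => hj.unique hi⟩
  · obtain ⟨r, hr, hAr⟩ := (isMatrixRepresentation_iff A hU hV).1 h
    refine ⟨not_linearIndependent_pair_iff_eq_one_or hU hV hAr, fun hUV => ?_⟩
    have key := hasNormalForm_iff_signatureCondition hr hU hV hUV hAr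
    exact ⟨key 0, key 1, key 2, key 3, key 4, key 5⟩
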